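/- Let $2^{<\omega}$ and $2^\omega$ denote the sets of finite and of infinite binary sequences. For $\sigma\in 2^{<\omega}$ let $[\![\sigma]\!]\subseteq 2^\omega$ be the set of infinite extensions of $\sigma$. For $p\in[0,1]$ let $\mu_p$ be the Bernoulli $p$-measure on $2^\omega$: the probability measure with $\mu_p(\sigma):=\mu_p([\![\sigma]\!])=p^{\#_0(\sigma)}(1-p)^{\#_1(\sigma)}$, where $\#_i(\sigma)$ is the number of occurrences of the symbol $i$ in $\sigma$. As an oracle, $p$ is identified with its binary expansion. A sequence $x\in2^\omega$ is *Bernoulli $p$-random* if $x\notin\bigcap_i U_i$ for every sequence $(U_i)_{i\in\omega}$ of uniformly $\Sigma^{0,p}_1$ subsets of $2^\omega$ (effectively open relative to $p$, uniformly in $i$) with $\mu_p(U_i)\le 2^{-i}$ for all $i$. A *semimeasure* is a function $\rho:2^{<\omega}\to[0,1]$ with $\rho(\emptyset)\le 1$ and $\rho(\sigma)\ge\rho(\sigma0)+\rho(\sigma1)$ for all $\sigma$; it is *left-c.e.* if, uniformly in $\sigma$, $\rho(\sigma)$ is the limit of a computable non-decreasing sequence of rational numbers. A left-c.e. semimeasure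 $M$ is *universal* if for every left-c.e. semimeasure $\rho$ there is a real $c>0$ with $M(\sigma)\ge c\,\rho(\sigma)$ for all $\sigma$. For such $M$, the a priori complexity is $\mathit{KA}(\sigma)=-\log_2 M(\sigma)$; no oracle is involved, and the choice of $M$ affects $\mathit{KA}$ only by a bounded additive term. **Theorem.** Let $p\in[0,1]$ satisfy $p\ge_T\emptyset'$, where $\emptyset'$ is the halting set. Then there is a sequence $y\in2^\omega$ that is not Bernoulli $p$-random such that, for every universal left-c.e. semimeasure $M$ with its a priori complexity $\mathit{KA}$, there is a constant $C$ with $$\mathit{KA}(y{\upharpoonright}n)\ \ge\ -\log_2\mu_p(y{\upharpoonright}n)-C\qquad\text{for all } n\in\omega .$$ -/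

import Mathlib

noncomputable section

namespace BlindBernoulli

/-! ### Strings, sequences and Bernoulli measures

The bit `0` is `false`, the bit `1` is `true`; finite binary strings are `List Bool` and infinite
binary sequences are `ℕ → Bool`. -/

/-- The initial segment of length `n` of `x`. -/
def initSeg (x : ℕ → Bool) (n : ℕ) : List Bool := (List.range n).map x

/-- The basic open set of all infinite sequences that extend the string `σ`. -/
def cylinder (σ : List Bool) : Set (ℕ → Bool) := {x | initSeg x σ.length = σ}

/-- The Bernoulli `p`-measure: the bits are independent, and each is `0` with probability `p` and
`1` with probability `1 - p`. -/
def bernoulliMeas (p : unitInterval) : MeasureTheory.Measure (ℕ → Bool) :=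
  MeasureTheory.Measure.infinitePi fun _ : ℕ => ProbabilityTheory.bernoulliMeasure false true p

/-! ### Oracles -/

/-- A real `p ∈ [0,1]` as an oracle: the `n`-th digit after the binary point of `p`. (For dyadic
`p` this picks one of the expansions; for `p = 1` it is the zero sequence, which is computable,
as is every binary expansion of a rational number.) -/
def binaryDigit (p : unitInterval) (n : ℕ) : ℕ := ⌊(2 : ℝ) ^ (n + 1) * (p : ℝ)⌋₊ % 2

/-- The characteristic function of `∅′`, the halting set: the set of all `e` such that the `e`-th
partial recursive function halts on input `e`. -/
def zeroJump (e : ℕ) : ℕ :=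
  open Classical in
  if ((Denumerable.ofNat Nat.Partrec.Code e).eval e).Dom then 1 else 0

/-- `p` computes the halting set: `p ≥_T ∅′`. -/
def ComputesZeroJump (p : unitInterval) : Prop :=
  TuringReducible (fun e => Part.some (zeroJump e)) (fun n => Part.some (binaryDigit p n))

/-! ### Martin-Löf tests and Bernoulli randomness -/

/-- `U` is a uniformly `Σ⁰₁` sequence of classes relative to the oracle `p`: for some set of pairs
`(i, σ)` that is recursively enumerable in `p` (the domain of a function `f` that is partial
recursive in `p`), `U i` is the union of the basic open sets of the `σ` with `(i, σ)` in that
set. -/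
def UniformlySigma1 (p : unitInterval) (U : ℕ → Set (ℕ → Bool)) : Prop :=
  ∃ f : ℕ × List Bool →. ℕ,
    RecursiveIn {fun n => Part.some (binaryDigit p n)} f ∧
      ∀ i, U i = ⋃ σ ∈ {σ : List Bool | (f (i, σ)).Dom}, cylinder σ

/-- `U` is a `μ_p`-Martin-Löf test relative to `p`. -/
def IsBernoulliTest (p : unitInterval) (U : ℕ → Set (ℕ → Bool)) : Prop :=
  UniformlySigma1 p U ∧ ∀ i : ℕ, bernoulliMeas p (U i) ≤ (2 : ENNReal)⁻¹ ^ i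

/-- `x` is Bernoulli `p`-random: it passes every `μ_p`-Martin-Löf test relative to `p`. -/
def BernoulliRandom (p : unitInterval) (x : ℕ → Bool) : Prop :=
  ∀ U : ℕ → Set (ℕ → Bool), IsBernoulliTest p U → x ∉ ⋂ i, U i

/-! ### A priori complexity -/

/-- Semimeasures `ρ : 2^{<ω} → [0,1]`. -/
structure IsSemimeasure (ρ : List Bool → ℝ) : Prop where
  mem_Icc : ∀ σ, ρ σ ∈ Set.Icc (0 : ℝ) 1
  nil_le_one : ρ [] ≤ 1
  add_le : ∀ σ, ρ (σ ++ [false]) + ρ (σ ++ [true]) ≤ ρ σ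

/-- `ρ` is left-c.e.: uniformly in `σ`, the value `ρ σ` is the limit of a computable,
non-decreasing sequence of (non-negative) rational numbers `num σ s / (den σ s + 1)`. Restricting
to non-negative rationals is harmless for `ρ ≥ 0`, as negative terms can be replaced by `0`. -/
def IsLeftCE (ρ : List Bool → ℝ) : Prop :=
  ∃ num den : List Bool → ℕ → ℕ, Computable₂ num ∧ Computable₂ den ∧
    ∀ σ, Monotone (fun s => (num σ s : ℝ) / ((den σ s : ℝ) + 1)) ∧
      Filter.Tendsto (fun s => (num σ s : ℝ) / ((den σ s : ℝ) + 1)) Filter.atTop (nhds (ρ σ))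

/-- `M` is a universal left-c.e. semimeasure: it is a left-c.e. semimeasure and dominates every
left-c.e. semimeasure up to a positive multiplicative constant. -/
structure IsUniversalSemimeasure (M : List Bool → ℝ) : Prop where
  isSemimeasure : IsSemimeasure M
  isLeftCE : IsLeftCE M
  dominates : ∀ ρ : List Bool → ℝ, IsSemimeasure ρ → IsLeftCE ρ →
    ∃ c : ℝ, 0 < c ∧ ∀ σ, c * ρ σ ≤ M σ

/-- The a priori complexity `KA(σ) = -log M(σ)` given by a universal left-c.e. semimeasure `M`
(which is everywhere positive); logarithms are binary. -/
def KA (M : List Bool → ℝ) (σ : List Bool) : ℝ := -Real.logb 2 (M σ)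

end BlindBernoulli

end

/-! Let `ρ` be a universal semimeasure. Since `ρ(σ0) + ρ(σ1) ≤ ρ(σ) = p ρ(σ) + (1 - p) ρ(σ)`, some
bit `b` satisfies `ρ(σb) ≤ μ_p(b) ρ(σ)`; always following such a bit keeps `ρ / μ_p` bounded. As `p`
computes `∅′`, it computes `ρ` to any dyadic precision (`IsLeftCE.computableIn_ceil`), hence finds
such a bit up to a small error (`apply_append_greedyBit_le`). A precision exponential in `|σ|` makes
the total error, relative to `μ_p`, a convergent series. The resulting sequence is computable from
`p`, and `0 < p < 1` because `p` is not computable, so the shrinking cylinders around the sequence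
form a test that it fails (`not_bernoulliRandom_of_computableIn`). -/

namespace BlindBernoulli

/-! ### Relative computability and the halting set. -/

section Computability

variable {α β γ : Type*} [Primcodable α] [Primcodable β] [Primcodable γ] {O : Set (ℕ →. ℕ)}

theorem RecursiveIn.comp_computableIn {f : β →. γ} {g : α → β} (hf : RecursiveIn O f)
    (hg : ComputableIn O g) : RecursiveIn O fun a => f (g a) := by
  refine (Nat.RecursiveIn.comp hf hg).of_eq fun n => ?_
  cases (Encodable.decode n : Option α) <;> simp

theorem ComputableIn.comp {f : β → γ} {g : α → β} (hf : ComputableIn O f)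
    (hg : ComputableIn O g) : ComputableIn O fun a => f (g a) :=
  RecursiveIn.comp_computableIn (f := fun b => Part.some (f b)) hf hg

theorem ComputableIn.pair {f : α → β} {g : α → γ} (hf : ComputableIn O f)
    (hg : ComputableIn O g) : ComputableIn O fun a => (f a, g a) := by
  refine (Nat.RecursiveIn.pair hf hg).of_eq fun n => ?_
  cases (Encodable.decode n : Option α) <;> simp [Seq.seq]

/-- Unbounded search for a zero of a function that is computable in `O`. -/
theorem RecursiveIn.rfind_zero {f : α × ℕ → ℕ} (hf : ComputableIn O f) :
    RecursiveIn O fun a => Nat.rfind fun m => Part.some (decide (f (a, m) = 0)) := by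
  refine (Nat.RecursiveIn.rfind hf).of_eq fun n => ?_
  cases h : (Encodable.decode n : Option α) with
  | none =>
    simp only [Part.coe_none, Part.bind_none]
    refine Part.eq_none_iff.2 fun a ha => ?_
    have := Nat.rfind_spec ha
    simp [h] at this
  | some a =>
    simp [h, Part.map_id']

/-- The least zero of a function that is computable in `O` is computable in `O`. -/
theorem ComputableIn.of_least_zero {f : α × ℕ → ℕ} {g : α → ℕ} (hf : ComputableIn O f)
    (h0 : ∀ a, f (a, g a) = 0) (h1 : ∀ a, ∀ m < g a, f (a, m) ≠ 0) : ComputableIn O g := by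
  refine (RecursiveIn.rfind_zero hf).of_eq_tot fun a => ?_
  exact Nat.mem_rfind.2 ⟨by simp [h0], fun {m} hm => by simp [h1 a m hm]⟩

/-- Primitive recursion; the second argument of the step function is the stage. -/
theorem ComputableIn.of_rec {f : ℕ × ℕ → ℕ} {g : ℕ → ℕ} {x : ℕ} (hf : ComputableIn O f)
    (h0 : g 0 = x) (h1 : ∀ n, g (n + 1) = f (g n, n)) : ComputableIn O g := by
  have hx : Nat.RecursiveIn O fun _ => Part.some x :=
    RecursiveIn.iff_nat.1 (ComputableIn.const (O := O) (α := ℕ) x)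
  have h2 : Computable fun n : ℕ => n.unpair.2 := Computable.snd.comp Computable.unpair
  have hr : ComputableIn O fun n : ℕ => f (n.unpair.2.unpair.2, n.unpair.2.unpair.1) :=
    ComputableIn.comp hf (Computable.computableIn
      ((h2.comp h2).pair ((Computable.fst.comp Computable.unpair).comp h2)))
  have := Nat.RecursiveIn.prec hx (RecursiveIn.iff_nat.1 hr)
  have hp : ComputableIn O fun n : ℕ => Nat.pair 0 n :=
    Computable.computableIn (Primrec₂.natPair.to_comp.comp (Computable.const 0) Computable.id)
  refine (RecursiveIn.comp_computableIn (RecursiveIn.iff_nat.2 this) hp).of_eq fun n => ?_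
  simp only [Nat.unpair_pair]
  induction n with
  | zero => simp [h0]
  | succ n ih =>
    dsimp only at ih ⊢
    rw [ih, h1]
    exact Part.bind_some _ _

/-- The domain of a partial recursive function is many-one reducible to the halting set. -/
theorem exists_computable_zeroJump {f : α →. β} (hf : Partrec f) :
    ∃ e : α → ℕ, Computable e ∧ ∀ a, zeroJump (e a) = 0 ↔ ¬ (f a).Dom := by
  -- After `left`, the curried program ignores its own input, so running it on its own index
  -- simulates `f a`.
  obtain ⟨c, hc⟩ := Nat.Partrec.Code.exists_code.1 (Nat.Partrec.comp hf Nat.Partrec.left)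
  refine ⟨fun a => Encodable.encode (Nat.Partrec.Code.curry c (Encodable.encode a)),
    Computable.encode.comp (Nat.Partrec.Code.primrec₂_curry.to_comp.comp (Computable.const c)
      Computable.encode), fun a => ?_⟩
  simp [zeroJump, Nat.Partrec.Code.eval_curry, hc]

theorem not_computable_zeroJump : ¬ Computable zeroJump := by
  intro h
  refine ComputablePred.halting_problem 0 ?_
  have hp : Partrec fun c : Nat.Partrec.Code => c.eval 0 :=
    Nat.Partrec.Code.eval_part.comp Computable.id (Computable.const 0)
  obtain ⟨e, he, H⟩ := exists_computable_zeroJump hp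
  refine ComputablePred.computable_iff.2
    ⟨fun c => !(decide (zeroJump (e c) = 0)), ?_, ?_⟩
  · have hd : Computable fun n : ℕ => decide (n = 0) :=
      ((Primrec.eq (α := ℕ)).decide.comp Primrec.id (Primrec.const 0)).to_comp
    exact Primrec.not.to_comp.comp (hd.comp (h.comp he))
  · funext c
    simp [H]

end Computability

/-! ### The digits of `p` as an oracle. -/

section Oracle

variable {p : unitInterval}

/-- A computable oracle can be eliminated, which would make the halting set computable. This rules
out `p = 0` and `p = 1`. -/
theorem not_computable_binaryDigit (hp : ComputesZeroJump p) : ¬ Computable (binaryDigit p) := by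
  intro h
  exact not_computable_zeroJump (RecursiveIn.partrec_of_oracle (fun g hg => by
    rw [Set.mem_singleton_iff.1 hg]; exact h) hp)

theorem pos_of_computesZeroJump (hp : ComputesZeroJump p) : 0 < (p : ℝ) := by
  refine lt_of_le_of_ne p.2.1 fun h => not_computable_binaryDigit hp ?_
  have : binaryDigit p = fun _ => 0 := by funext n; simp [binaryDigit, ← h]
  rw [this]; exact Computable.const 0

theorem lt_one_of_computesZeroJump (hp : ComputesZeroJump p) : (p : ℝ) < 1 := by
  refine lt_of_le_of_ne p.2.2 fun h => not_computable_binaryDigit hp ?_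
  have : binaryDigit p = fun _ => 0 := by
    funext n
    have : ⌊(2 : ℝ) ^ (n + 1)⌋₊ = 2 ^ (n + 1) := by
      rw [← Nat.floor_natCast (R := ℝ) (2 ^ (n + 1))]; push_cast; rfl
    rw [binaryDigit, h, mul_one, this, pow_succ, Nat.mul_mod_left]
  rw [this]; exact Computable.const 0

theorem computableIn_binaryDigit (p : unitInterval) :
    ComputableIn {fun n => Part.some (binaryDigit p n)} (binaryDigit p) :=
  RecursiveIn.oracle _ rfl

/-- Horner's scheme on the digits; `p < 1` makes the starting value `0`. -/
theorem computableIn_floor_two_pow_mul (hp1 : (p : ℝ) < 1) :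
    ComputableIn {fun n => Part.some (binaryDigit p n)} fun k : ℕ => ⌊(2 : ℝ) ^ k * (p : ℝ)⌋₊ := by
  have hf : ComputableIn {fun n => Part.some (binaryDigit p n)}
      fun x : ℕ × ℕ => 2 * x.1 + binaryDigit p x.2 := by
    have h1 : Primrec fun x : ℕ × ℕ => 2 * x.1 + x.2 :=
      Primrec.nat_add.comp (Primrec.nat_mul.comp (Primrec.const 2) Primrec.fst) Primrec.snd
    exact ComputableIn.comp (f := fun x : ℕ × ℕ => 2 * x.1 + x.2)
      (g := fun x : ℕ × ℕ => (x.1, binaryDigit p x.2)) h1.computableIn (ComputableIn.pair ComputableIn.fst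
      (ComputableIn.comp (computableIn_binaryDigit p) ComputableIn.snd))
  have h0 : ⌊(2 : ℝ) ^ 0 * (p : ℝ)⌋₊ = 0 := by simpa using hp1
  have h1 : ∀ n : ℕ, ⌊(2 : ℝ) ^ (n + 1) * (p : ℝ)⌋₊ =
      2 * ⌊(2 : ℝ) ^ n * (p : ℝ)⌋₊ + binaryDigit p n := fun n => by
    have : ⌊(2 : ℝ) ^ n * (p : ℝ)⌋₊ = ⌊(2 : ℝ) ^ (n + 1) * (p : ℝ)⌋₊ / 2 := by
      rw [← Nat.floor_div_ofNat]
      congr 1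
      rw [pow_succ]; ring
    rw [this, binaryDigit]
    omega
  generalize hg : (fun k : ℕ => ⌊(2 : ℝ) ^ k * (p : ℝ)⌋₊) = g
  have hg' : ∀ k, ⌊(2 : ℝ) ^ k * (p : ℝ)⌋₊ = g k := fun k => congrFun hg k
  simp only [hg'] at h0 h1
  exact ComputableIn.of_rec hf h0 h1

end Oracle


/-! ### Cylinder measures and non-randomness. -/

section Measure

variable {p : unitInterval}

theorem length_initSeg (x : ℕ → Bool) (n : ℕ) : (initSeg x n).length = n := by simp [initSeg]

theorem initSeg_succ (x : ℕ → Bool) (n : ℕ) : initSeg x (n + 1) = initSeg x n ++ [x n] := by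
  simp [initSeg, List.range_succ]

theorem mem_cylinder_initSeg (x y : ℕ → Bool) (n : ℕ) :
    x ∈ cylinder (initSeg y n) ↔ ∀ i < n, x i = y i := by
  simp [cylinder, initSeg]

/-- The probability of the bit `b` under the Bernoulli `p`-measure. -/
def bitProb (p : unitInterval) (b : Bool) : ℝ := if b then 1 - (p : ℝ) else p

theorem bernoulliMeas_real_cylinder (p : unitInterval) (y : ℕ → Bool) (n : ℕ) :
    (bernoulliMeas p).real (cylinder (initSeg y n)) =
      ∏ i ∈ Finset.range n, bitProb p (y i) := by
  have h : cylinder (initSeg y n) = Set.pi (Finset.range n) fun i => {y i} := by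
    ext x; simp [mem_cylinder_initSeg]
  rw [h, bernoulliMeas, MeasureTheory.measureReal_def, MeasureTheory.Measure.infinitePi_pi _
    (fun _ _ => MeasurableSet.singleton _), ENNReal.toReal_prod]
  refine Finset.prod_congr rfl fun i _ => ?_
  rw [← MeasureTheory.measureReal_def,
    ProbabilityTheory.bernoulliMeasure_real_apply _ (MeasurableSet.singleton _)]
  cases y i <;> simp [bitProb]

instance (p : unitInterval) : MeasureTheory.IsProbabilityMeasure (bernoulliMeas p) := by
  unfold bernoulliMeas; infer_instance

theorem bitProb_pos (h0 : 0 < (p : ℝ)) (h1 : (p : ℝ) < 1) (b : Bool) : 0 < bitProb p b := by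
  cases b <;> simp [bitProb, h0, h1]

/-- A sequence that is computable from `p` is not Bernoulli `p`-random unless `p` is `0` or `1`. -/
theorem not_bernoulliRandom_of_computableIn (h0 : 0 < (p : ℝ)) (h1 : (p : ℝ) < 1) {y : ℕ → Bool}
    (hy : ComputableIn {fun n => Part.some (binaryDigit p n)}
      fun n => Encodable.encode (initSeg y n)) :
    ¬ BernoulliRandom p y := by
  obtain ⟨q, hq1, hq⟩ : ∃ q : ℝ, q < 1 ∧ ∀ b, bitProb p b ≤ q :=
    ⟨max p (1 - p), by simp [h0, h1], fun b => by cases b <;> simp [bitProb]⟩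
  have hq0 : 0 < q := (bitProb_pos h0 h1 true).trans_le (hq true)
  -- A prefix of length `K * i` has measure at most `(q ^ K) ^ i ≤ 2⁻¹ ^ i`.
  obtain ⟨K, hK⟩ := exists_pow_lt_of_lt_one (show (0 : ℝ) < 2⁻¹ by norm_num) hq1
  intro hr
  refine hr (fun i => cylinder (initSeg y (K * i))) ⟨?_, fun i => ?_⟩
    (Set.mem_iInter.2 fun i => (mem_cylinder_initSeg _ _ _).2 fun _ _ => rfl)
  · have hd : Primrec fun x : ℕ × ℕ => if x.1 = x.2 then 0 else 1 :=
      Primrec.ite (Primrec.eq.comp Primrec.fst Primrec.snd) (Primrec.const 0) (Primrec.const 1)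
    have hm : Primrec fun x : (ℕ × List Bool) × ℕ => K * x.1.1 :=
      Primrec.nat_mul.comp (Primrec.const K) (Primrec.fst.comp Primrec.fst)
    have he : Primrec fun x : (ℕ × List Bool) × ℕ => Encodable.encode x.1.2 :=
      Primrec.encode.comp (Primrec.snd.comp Primrec.fst)
    have hY := ComputableIn.comp (f := fun n => Encodable.encode (initSeg y n))
      (g := fun x : (ℕ × List Bool) × ℕ => K * x.1.1) hy hm.computableIn
    have hf := ComputableIn.comp (f := fun x : ℕ × ℕ => if x.1 = x.2 then 0 else 1)
      (g := fun x : (ℕ × List Bool) × ℕ =>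
        (Encodable.encode x.1.2, Encodable.encode (initSeg y (K * x.1.1))))
      hd.computableIn (ComputableIn.pair he.computableIn hY)
    -- The search condition does not depend on the search variable, so the search stops at once or
    -- never.
    refine ⟨_, RecursiveIn.rfind_zero hf, fun i => ?_⟩
    have : {σ : List Bool | (Nat.rfind fun m => Part.some (decide ((fun x : (ℕ × List Bool) × ℕ =>
        if Encodable.encode x.1.2 = Encodable.encode (initSeg y (K * x.1.1)) then 0 else 1)
          ((i, σ), m) = 0))).Dom} = {initSeg y (K * i)} := by
      ext σ
      simp only [Set.mem_ofPred_eq, Set.mem_singleton_iff]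
      constructor
      · intro h
        have := Nat.rfind_spec (Part.get_mem h)
        simpa using this
      · intro h
        exact Nat.rfind_dom.2 ⟨0, by simp [h], fun _ => trivial⟩
    dsimp only at this ⊢
    rw [this]
    simp
  · rw [← ENNReal.ofReal_toReal (MeasureTheory.measure_ne_top (bernoulliMeas p) _),
      ← MeasureTheory.measureReal_def, bernoulliMeas_real_cylinder]
    have h2 : (2 : ENNReal)⁻¹ ^ i = ENNReal.ofReal ((2 : ℝ)⁻¹ ^ i) := by
      rw [ENNReal.ofReal_pow (by norm_num), ENNReal.ofReal_inv_of_pos (by norm_num)]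
      simp
    rw [h2]
    refine ENNReal.ofReal_le_ofReal ?_
    calc ∏ j ∈ Finset.range (K * i), bitProb p (y j)
        ≤ ∏ _j ∈ Finset.range (K * i), q :=
          Finset.prod_le_prod (fun j _ => (bitProb_pos h0 h1 _).le) fun j _ => hq _
      _ = (q ^ K) ^ i := by simp [pow_mul]
      _ ≤ (2 : ℝ)⁻¹ ^ i := pow_le_pow_left₀ (by positivity) hK.le i

end Measure

/-! ### Left-c.e. functions and `∅′`. -/

section LeftCE

variable {p : unitInterval} {ρ : List Bool → ℝ}

/-- The strict lower cuts of a left-c.e. function, at dyadic rationals, are uniformly c.e. -/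
theorem IsLeftCE.exists_partrec_lt (hρ : IsLeftCE ρ) :
    ∃ f : (List Bool × ℕ) × ℕ →. ℕ, Partrec f ∧
      ∀ σ k a, (f ((σ, k), a)).Dom ↔ (a : ℝ) < 2 ^ k * ρ σ := by
  obtain ⟨num, den, hnum, hden, h⟩ := hρ
  have hpow : Primrec₂ fun m n : ℕ => m ^ n := Primrec₂.unpaired'.1 Nat.Primrec.pow
  have hσ : Computable fun x : ((List Bool × ℕ) × ℕ) × ℕ => x.1.1.1 :=
    Computable.fst.comp (Computable.fst.comp Computable.fst)
  have h1 : Computable fun x : ((List Bool × ℕ) × ℕ) × ℕ => x.1.2 * (den x.1.1.1 x.2 + 1) :=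
    Primrec.nat_mul.to_comp.comp (Computable.snd.comp Computable.fst)
      (Computable.succ.comp (hden.comp hσ Computable.snd))
  have h2 : Computable fun x : ((List Bool × ℕ) × ℕ) × ℕ => 2 ^ x.1.1.2 * num x.1.1.1 x.2 :=
    Primrec.nat_mul.to_comp.comp (hpow.to_comp.comp (Computable.const 2)
      (Computable.snd.comp (Computable.fst.comp Computable.fst)))
      (hnum.comp hσ Computable.snd)
  have h3 : Computable₂ fun (x : (List Bool × ℕ) × ℕ) (t : ℕ) =>
      decide (x.2 * (den x.1.1 t + 1) < 2 ^ x.1.2 * num x.1.1 t) :=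
    Primrec.nat_lt.decide.to_comp.comp h1 h2
  refine ⟨_, Partrec.rfind h3.partrec₂, fun σ k a => ?_⟩
  obtain ⟨hmono, hlim⟩ := h σ
  have key : ∀ t, a * (den σ t + 1) < 2 ^ k * num σ t ↔
      (a : ℝ) < 2 ^ k * ((num σ t : ℝ) / ((den σ t : ℝ) + 1)) := fun t => by
    have : (0 : ℝ) < (den σ t : ℝ) + 1 := by positivity
    rw [← mul_div_assoc, lt_div_iff₀ this]
    exact_mod_cast Iff.rfl
  constructor
  · intro hd
    have := Nat.rfind_spec (Part.get_mem hd)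
    simp only [PFun.coe_val, Part.mem_some_iff] at this
    refine ((key _).1 (of_decide_eq_true this.symm)).trans_le ?_
    gcongr
    exact hmono.ge_of_tendsto hlim _
  · intro hlt
    obtain ⟨t, ht⟩ := ((hlim.const_mul ((2 : ℝ) ^ k)).eventually_const_lt hlt).exists
    exact Nat.rfind_dom.2 ⟨t, by simpa using (key t).2 ht, fun _ => trivial⟩

/-- Dyadic approximations from above to a left-c.e. function are computable from `∅′`. -/
theorem IsLeftCE.computableIn_ceil (hρ : IsLeftCE ρ) (hp : ComputesZeroJump p) :
    ComputableIn {fun n => Part.some (binaryDigit p n)}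
      fun x : List Bool × ℕ => ⌈2 ^ x.2 * ρ x.1⌉₊ := by
  obtain ⟨f, hf, h⟩ := hρ.exists_partrec_lt
  obtain ⟨e, he, H⟩ := exists_computable_zeroJump hf
  -- The ceiling is the least `a` for which the c.e. condition `a < 2 ^ k * ρ σ` fails.
  refine ComputableIn.of_least_zero (f := fun x => zeroJump (e x))
    (ComputableIn.comp (f := zeroJump) hp he.computableIn) (fun x => ?_) fun x m hm => ?_
  · rw [H, h, not_lt]; exact Nat.le_ceil _
  · rw [Ne, H, h, not_not]; exact Nat.lt_ceil.1 hm

end LeftCE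


/-! ### The greedy sequence. -/

section Greedy

variable {p : unitInterval} {ρ : List Bool → ℝ}

/-- The bit by which the greedy sequence extends `σ`: it is `0` if, up to the precision
`2 ^ (-L * |σ|)`, the value of `ρ` at `σ0` is at most `p * ρ σ`. -/
noncomputable def greedyBit (p : unitInterval) (ρ : List Bool → ℝ) (L : ℕ) (σ : List Bool) : Bool :=
  !decide (⌈2 ^ (L * σ.length) * ρ (σ ++ [false])⌉₊ * 2 ^ (L * σ.length) ≤
    ⌊(2 : ℝ) ^ (L * σ.length) * (p : ℝ)⌋₊ * ⌈2 ^ (L * σ.length) * ρ σ⌉₊)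

/-- The initial segments of the greedy sequence. -/
noncomputable def greedyString (p : unitInterval) (ρ : List Bool → ℝ) (L : ℕ) : ℕ → List Bool
  | 0 => []
  | n + 1 => greedyString p ρ L n ++ [greedyBit p ρ L (greedyString p ρ L n)]

/-- The sequence that follows bits along which `ρ / μ_p` almost does not increase. -/
noncomputable def greedySeq (p : unitInterval) (ρ : List Bool → ℝ) (L n : ℕ) : Bool :=
  greedyBit p ρ L (greedyString p ρ L n)

theorem initSeg_greedySeq (p : unitInterval) (ρ : List Bool → ℝ) (L n : ℕ) :
    initSeg (greedySeq p ρ L) n = greedyString p ρ L n := by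
  induction n with
  | zero => rfl
  | succ n ih => rw [initSeg_succ, ih]; rfl

theorem computableIn_greedyBit (hp : ComputesZeroJump p) (hρ : IsLeftCE ρ) (L : ℕ) :
    ComputableIn {fun n => Part.some (binaryDigit p n)} (greedyBit p ρ L) := by
  have hA := hρ.computableIn_ceil hp
  have hP := computableIn_floor_two_pow_mul (lt_one_of_computesZeroJump hp)
  have hpow : Primrec₂ fun m n : ℕ => m ^ n := Primrec₂.unpaired'.1 Nat.Primrec.pow
  have hk : Primrec fun σ : List Bool => L * σ.length :=
    Primrec.nat_mul.comp (Primrec.const L) Primrec.list_length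
  have h0 : Primrec fun σ : List Bool => (σ ++ [false], L * σ.length) :=
    Primrec.pair (Primrec.list_append.comp Primrec.id (Primrec.const [false])) hk
  have h1 : Primrec fun σ : List Bool => (σ, L * σ.length) := Primrec.pair Primrec.id hk
  have hc0 := ComputableIn.comp (f := fun x : List Bool × ℕ => ⌈2 ^ x.2 * ρ x.1⌉₊)
    (g := fun σ : List Bool => (σ ++ [false], L * σ.length)) hA h0.computableIn
  have hc1 := ComputableIn.comp (f := fun x : List Bool × ℕ => ⌈2 ^ x.2 * ρ x.1⌉₊)
    (g := fun σ : List Bool => (σ, L * σ.length)) hA h1.computableIn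
  have hc2 := ComputableIn.comp (f := fun k : ℕ => ⌊(2 : ℝ) ^ k * (p : ℝ)⌋₊)
    (g := fun σ : List Bool => L * σ.length) hP hk.computableIn
  have hc3 : ComputableIn {fun n => Part.some (binaryDigit p n)}
      fun σ : List Bool => 2 ^ (L * σ.length) :=
    Primrec.computableIn (f := fun σ : List Bool => 2 ^ (L * σ.length))
      (hpow.comp (Primrec.const 2) hk)
  have hcmp : Primrec fun x : (ℕ × ℕ) × (ℕ × ℕ) => !decide (x.1.1 * x.1.2 ≤ x.2.1 * x.2.2) :=
    Primrec.not.comp (Primrec.nat_le.decide.comp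
      (Primrec.nat_mul.comp (Primrec.fst.comp Primrec.fst) (Primrec.snd.comp Primrec.fst))
      (Primrec.nat_mul.comp (Primrec.fst.comp Primrec.snd) (Primrec.snd.comp Primrec.snd)))
  exact ComputableIn.comp
    (f := fun x : (ℕ × ℕ) × (ℕ × ℕ) => !decide (x.1.1 * x.1.2 ≤ x.2.1 * x.2.2))
    (g := fun σ : List Bool =>
      ((⌈2 ^ (L * σ.length) * ρ (σ ++ [false])⌉₊, 2 ^ (L * σ.length)),
        (⌊(2 : ℝ) ^ (L * σ.length) * (p : ℝ)⌋₊, ⌈2 ^ (L * σ.length) * ρ σ⌉₊)))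
    hcmp.computableIn (ComputableIn.pair (ComputableIn.pair hc0 hc3) (ComputableIn.pair hc2 hc1))

theorem computableIn_greedySeq (hp : ComputesZeroJump p) (hρ : IsLeftCE ρ) (L : ℕ) :
    ComputableIn {fun n => Part.some (binaryDigit p n)}
      fun n => Encodable.encode (initSeg (greedySeq p ρ L) n) := by
  have hstep : Primrec fun x : List Bool × Bool => Encodable.encode (x.1 ++ [x.2]) :=
    Primrec.encode.comp (Primrec.list_append.comp Primrec.fst
      (Primrec.list_cons.comp Primrec.snd (Primrec.const [])))
  -- The recursion carries the code of the whole prefix; the default `[]` is never reached.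
  have hdec : Primrec fun x : ℕ × ℕ => ((Encodable.decode x.1 : Option (List Bool)).getD []) :=
    Primrec.option_getD.comp (Primrec.decode.comp Primrec.fst) (Primrec.const [])
  have h1 := ComputableIn.comp (f := fun x : List Bool × Bool => Encodable.encode (x.1 ++ [x.2]))
    (g := fun σ : List Bool => (σ, greedyBit p ρ L σ)) hstep.computableIn
    (ComputableIn.pair ComputableIn.id (computableIn_greedyBit hp hρ L))
  have h2 := ComputableIn.comp h1 hdec.computableIn
  refine ComputableIn.of_rec (x := Encodable.encode ([] : List Bool)) h2 rfl fun n => ?_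
  simp only [initSeg_greedySeq, Encodable.encodek, Option.getD_some]
  rfl

/-- If the test for `0` fails, `ρ(σ0)` exceeds `p ρ(σ)` minus at most two units of precision, so
`ρ(σ1)` is at most `(1 - p) ρ(σ)` plus two units. Factoring out `1 - p` gives the constant. -/
theorem apply_append_greedyBit_le (h0 : 0 < (p : ℝ)) (h1 : (p : ℝ) < 1) (hρ : IsSemimeasure ρ)
    (L : ℕ) (σ : List Bool) :
    ρ (σ ++ [greedyBit p ρ L σ]) ≤ bitProb p (greedyBit p ρ L σ) *
      (ρ σ + 2 / (1 - p) * (2⁻¹ : ℝ) ^ (L * σ.length)) := by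
  have hq : 0 < 1 - (p : ℝ) := by linarith
  have hσ := (hρ.mem_Icc σ)
  have hσ0 := (hρ.mem_Icc (σ ++ [false]))
  have hadd := hρ.add_le σ
  set k := L * σ.length with hk
  set T : ℝ := 2 ^ k with hT
  have hT1 : 1 ≤ T := one_le_pow₀ (by norm_num)
  have hTi : (2⁻¹ : ℝ) ^ k = T⁻¹ := by simp [hT]
  have hTT : T * T⁻¹ = 1 := mul_inv_cancel₀ (by positivity)
  have hTi0 : 0 < T⁻¹ := by positivity
  set a : ℕ := ⌈T * ρ σ⌉₊ with ha
  set a0 : ℕ := ⌈T * ρ (σ ++ [false])⌉₊ with ha0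
  set P : ℕ := ⌊T * (p : ℝ)⌋₊ with hP
  have ha1 : T * ρ σ ≤ a := Nat.le_ceil _
  have ha2 : (a : ℝ) < T * ρ σ + 1 := Nat.ceil_lt_add_one (mul_nonneg (by positivity) hσ.1)
  have hb1 : T * ρ (σ ++ [false]) ≤ a0 := Nat.le_ceil _
  have hb2 : (a0 : ℝ) < T * ρ (σ ++ [false]) + 1 :=
    Nat.ceil_lt_add_one (mul_nonneg (by positivity) hσ0.1)
  have hP1 : (P : ℝ) ≤ T * p := Nat.floor_le (by positivity)
  have hP2 : T * p < P + 1 := Nat.lt_floor_add_one _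
  have haT : (a : ℝ) ≤ T := by
    have : a ≤ 2 ^ k := Nat.ceil_le.2 (by push_cast; rw [← hT]; nlinarith [hσ.2])
    calc (a : ℝ) ≤ ((2 ^ k : ℕ) : ℝ) := Nat.cast_le.2 this
      _ = T := by push_cast; rfl
  have hbit : greedyBit p ρ L σ = !decide (a0 * 2 ^ k ≤ P * a) := rfl
  have ha0' : (0 : ℝ) ≤ a := Nat.cast_nonneg _
  rw [hTi]
  by_cases hc : a0 * 2 ^ k ≤ P * a
  · have hc' : (a0 : ℝ) * T ≤ P * a := by
      have := (Nat.cast_le (α := ℝ)).2 hc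
      push_cast at this
      exact this
    rw [hbit]
    simp only [hc, decide_true, Bool.not_true, bitProb, Bool.false_eq_true, if_false]
    have h3 : (a0 : ℝ) ≤ p * a := by
      have : (a0 : ℝ) * T ≤ (p * a) * T := by nlinarith
      exact le_of_mul_le_mul_right this (by positivity)
    have h4 : T * ρ (σ ++ [false]) ≤ T * (p * (ρ σ + T⁻¹)) := by
      have : T * (p * (ρ σ + T⁻¹)) = p * (T * ρ σ + T * T⁻¹) := by ring
      rw [this, hTT]; nlinarith
    have h5 : ρ (σ ++ [false]) ≤ p * (ρ σ + T⁻¹) := le_of_mul_le_mul_left h4 (by positivity)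
    refine h5.trans (mul_le_mul_of_nonneg_left ?_ h0.le)
    have : 1 ≤ 2 / (1 - (p : ℝ)) := by rw [le_div_iff₀ hq]; linarith
    nlinarith
  · have hc' : (P : ℝ) * a < a0 * T := by
      have := (Nat.cast_lt (α := ℝ)).2 (not_le.1 hc)
      push_cast at this
      exact this
    rw [hbit]
    simp only [hc, decide_false, Bool.not_false, bitProb, if_true]
    -- Rounding `T * p` down loses at most `a ≤ T`, hence at most one after division by `T`;
    -- rounding `a0` up costs the second unit.
    have h3 : (p : ℝ) * a - 1 < a0 := by
      have : ((p : ℝ) * a - 1) * T < (a0 : ℝ) * T := by nlinarith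
      exact lt_of_mul_lt_mul_right this (by positivity)
    have h4 : T * (p * ρ σ - 2 * T⁻¹) ≤ T * ρ (σ ++ [false]) := by
      have : T * (p * ρ σ - 2 * T⁻¹) = p * (T * ρ σ) - 2 * (T * T⁻¹) := by ring
      rw [this, hTT]; nlinarith
    have h5 : p * ρ σ - 2 * T⁻¹ ≤ ρ (σ ++ [false]) := le_of_mul_le_mul_left h4 (by positivity)
    have h6 : (1 - (p : ℝ)) * (ρ σ + 2 / (1 - p) * T⁻¹) = (1 - p) * ρ σ + 2 * T⁻¹ := by
      field_simp
    rw [h6]; linarith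

/-- Every left-c.e. semimeasure is bounded, up to a constant factor, by `μ_p` along some sequence
that is not Bernoulli `p`-random, if `p` computes the halting set. -/
theorem exists_not_bernoulliRandom_le (hp : ComputesZeroJump p) (hs : IsSemimeasure ρ)
    (hc : IsLeftCE ρ) :
    ∃ y : ℕ → Bool, ¬ BernoulliRandom p y ∧ ∃ C : ℝ, ∀ n,
      ρ (initSeg y n) ≤ C * (bernoulliMeas p).real (cylinder (initSeg y n)) := by
  have h0 := pos_of_computesZeroJump hp
  have h1 := lt_one_of_computesZeroJump hp
  obtain ⟨m, hm0, hm⟩ : ∃ m : ℝ, 0 < m ∧ ∀ b, m ≤ bitProb p b :=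
    ⟨min p (1 - p), by simp [h0, h1], fun b => by cases b <;> simp [bitProb]⟩
  -- With `2⁻¹ ^ L < m / 2`, the error at length `n` is at most `D * 2⁻¹ ^ n` times the measure of
  -- the prefix.
  obtain ⟨L, hL⟩ := exists_pow_lt_of_lt_one (show (0 : ℝ) < m / 2 by positivity)
    (show (2⁻¹ : ℝ) < 1 by norm_num)
  refine ⟨greedySeq p ρ L, not_bernoulliRandom_of_computableIn h0 h1
    (computableIn_greedySeq hp hc L), 1 + 2 * (2 / (1 - p)), fun n => ?_⟩
  set y := greedySeq p ρ L with hy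
  set D : ℝ := 2 / (1 - p) with hD
  have hD0 : 0 < D := div_pos two_pos (by linarith)
  rw [bernoulliMeas_real_cylinder]
  have hprod : ∀ n, m ^ n ≤ ∏ i ∈ Finset.range n, bitProb p (y i) := fun n => by
    calc m ^ n = ∏ _i ∈ Finset.range n, m := by simp
      _ ≤ _ := Finset.prod_le_prod (fun _ _ => hm0.le) fun i _ => hm _
  have hpow : ∀ n, (2⁻¹ : ℝ) ^ (L * n) ≤ (∏ i ∈ Finset.range n, bitProb p (y i)) * 2⁻¹ ^ n := by
    intro n
    calc (2⁻¹ : ℝ) ^ (L * n) ≤ (m / 2) ^ n := by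
          rw [pow_mul]; exact pow_le_pow_left₀ (by positivity) hL.le n
      _ = m ^ n * 2⁻¹ ^ n := by rw [div_eq_mul_inv, mul_pow]
      _ ≤ _ := mul_le_mul_of_nonneg_right (hprod n) (by positivity)
  -- `2 * D * (1 - 2⁻¹ ^ n)` is the sum of the errors `D * 2⁻¹ ^ i` over `i < n`.
  have main : ∀ n, ρ (initSeg y n) ≤
      (1 + 2 * D * (1 - 2⁻¹ ^ n)) * ∏ i ∈ Finset.range n, bitProb p (y i) := by
    intro n
    induction n with
    | zero => simpa [initSeg] using hs.nil_le_one
    | succ n ih =>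
      have hstep := apply_append_greedyBit_le h0 h1 hs L (initSeg y n)
      have hb : greedyBit p ρ L (initSeg y n) = y n := by
        rw [hy, initSeg_greedySeq]; rfl
      rw [hb, length_initSeg] at hstep
      rw [initSeg_succ, Finset.prod_range_succ]
      refine hstep.trans ?_
      have h2 : ρ (initSeg y n) + D * 2⁻¹ ^ (L * n) ≤
          (1 + 2 * D * (1 - 2⁻¹ ^ (n + 1))) * ∏ i ∈ Finset.range n, bitProb p (y i) := by
        have := mul_le_mul_of_nonneg_left (hpow n) hD0.le
        rw [pow_succ]
        linarith
      calc _ ≤ bitProb p (y n) * _ := mul_le_mul_of_nonneg_left h2 (bitProb_pos h0 h1 _).le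
        _ = _ := by ring
  refine (main n).trans (mul_le_mul_of_nonneg_right ?_ ((pow_pos hm0 n).le.trans (hprod n)))
  nlinarith [pow_pos (show (0 : ℝ) < 2⁻¹ by norm_num) n]

end Greedy

/-! ### Positivity of universal semimeasures. -/

section Universal

/-- The uniform measure, as a function on strings. -/
noncomputable def uniformMeas (σ : List Bool) : ℝ := 2⁻¹ ^ σ.length

theorem isSemimeasure_uniformMeas : IsSemimeasure uniformMeas where
  mem_Icc σ := ⟨by unfold uniformMeas; positivity, pow_le_one₀ (by norm_num) (by norm_num)⟩
  nil_le_one := by simp [uniformMeas]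
  add_le σ := by simp only [uniformMeas, List.length_append, List.length_singleton, pow_succ]; linarith

theorem isLeftCE_uniformMeas : IsLeftCE uniformMeas := by
  have hpow : Primrec₂ fun m n : ℕ => m ^ n := Primrec₂.unpaired'.1 Nat.Primrec.pow
  -- The `- 1` offsets the `+ 1` in the denominators of `IsLeftCE`.
  refine ⟨fun _ _ => 1, fun σ _ => 2 ^ σ.length - 1, Computable.const 1,
    (Primrec.nat_sub.comp (hpow.comp (Primrec.const 2) (Primrec.list_length.comp Primrec.fst))
      (Primrec.const 1)).to_comp, fun σ => ⟨monotone_const, ?_⟩⟩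
  have : ((1 : ℕ) : ℝ) / (((2 ^ σ.length - 1 : ℕ) : ℝ) + 1) = uniformMeas σ := by
    rw [Nat.cast_sub Nat.one_le_two_pow]
    simp [uniformMeas]
  exact tendsto_const_nhds.congr fun _ => this.symm

theorem IsUniversalSemimeasure.pos {M : List Bool → ℝ} (hM : IsUniversalSemimeasure M)
    (σ : List Bool) : 0 < M σ := by
  obtain ⟨c, hc, h⟩ := hM.dominates _ isSemimeasure_uniformMeas isLeftCE_uniformMeas
  exact (mul_pos hc (by unfold uniformMeas; positivity)).trans_le (h σ)

end Universal

end BlindBernoulli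

/-! ### The theorem. -/

open BlindBernoulli in
theorem theorem5p2 (p : unitInterval) (hp : BlindBernoulli.ComputesZeroJump p) :
    ∃ y : ℕ → Bool, ¬ BlindBernoulli.BernoulliRandom p y ∧
      ∀ M : List Bool → ℝ, BlindBernoulli.IsUniversalSemimeasure M →
        ∃ C : ℝ, ∀ n : ℕ,
          BlindBernoulli.KA M (BlindBernoulli.initSeg y n) ≥
            -Real.logb 2 ((BlindBernoulli.bernoulliMeas p).real
              (BlindBernoulli.cylinder (BlindBernoulli.initSeg y n))) - C := by
  -- `y` must be chosen before `M`, so one `ρ` has to dominate every universal `M`. Any universal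
  -- one does; were there none, any left-c.e. semimeasure would serve vacuously.
  obtain ⟨ρ, hs, hc, hρ⟩ : ∃ ρ, IsSemimeasure ρ ∧ IsLeftCE ρ ∧
      ∀ M, IsUniversalSemimeasure M → ∃ c : ℝ, 0 < c ∧ ∀ σ, c * M σ ≤ ρ σ := by
    by_cases h : ∃ M, IsUniversalSemimeasure M
    · obtain ⟨M₀, h₀⟩ := h
      exact ⟨M₀, h₀.isSemimeasure, h₀.isLeftCE,
        fun M hM => h₀.dominates M hM.isSemimeasure hM.isLeftCE⟩
    · exact ⟨_, isSemimeasure_uniformMeas, isLeftCE_uniformMeas, fun M hM => (h ⟨M, hM⟩).elim⟩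
  obtain ⟨y, hy, C, hC⟩ := exists_not_bernoulliRandom_le hp hs hc
  refine ⟨y, hy, fun M hM => ?_⟩
  obtain ⟨c, hc0, hcM⟩ := hρ M hM
  refine ⟨Real.logb 2 (C / c), fun n => ?_⟩
  have hM0 := hM.pos (initSeg y n)
  have hle := (hcM _).trans (hC n)
  set μ := (bernoulliMeas p).real (cylinder (initSeg y n)) with hμ
  have hμ0 : 0 ≤ μ := MeasureTheory.measureReal_nonneg
  -- Positivity of `M` forces that of `μ` and `C`, as the logarithm laws require.
  have hpos : 0 < C * μ := (mul_pos hc0 hM0).trans_le hle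
  have hμ1 : 0 < μ := lt_of_le_of_ne hμ0 fun h => by simp [← h] at hpos
  have hC0 : 0 < C := pos_of_mul_pos_left hpos hμ0
  have h1 : M (initSeg y n) ≤ C / c * μ := by
    rw [div_mul_eq_mul_div, le_div_iff₀ hc0]; linarith
  have h2 := Real.logb_le_logb_of_le one_lt_two hM0 h1
  rw [Real.logb_mul (div_pos hC0 hc0).ne' hμ1.ne'] at h2
  unfold KA
  linarith
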